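/- **Setting.** Let $\Pi$ be a finite set of node label symbols. A $\Pi$-labeled graph is a finite directed graph $G=(V,E,\lambda)$ (self-loops allowed) with $\lambda\colon V\to\mathcal P(\Pi)$; a pointed graph is a pair $(G,v)$ with $v\in V$. The out-neighbours of $v$ are the nodes $u$ with $(v,u)\in E$. *GMSC.* Formulae of graded modal logic (GML) over $\Pi$ are $\varphi ::= \top \mid p \mid \neg\varphi \mid \varphi\wedge\varphi \mid \Diamond_{\ge k}\varphi$ with $p\in\Pi$, $k\in\mathbb N$, where $G,v\models p$ iff $p\in\lambda(v)$, and $G,v\models\Diamond_{\ge k}\varphi$ iff at least $k$ out-neighbours of $v$ satisfy $\varphi$. A schema is defined by the same grammar with additional atoms $X_1,\dots,X_n$. A GMSC-program over $\Pi$ consists of terminal clauses $X_i(0) :- \varphi_i$ with $\varphi_i$ a GML-formula, iteration clauses $X_i :- \psi_i$ with $\psi_i$ a schema ($1\le i\le n$), and a set of appointed predicates among $X_1,\dots,X_n$. The iteration formulae are $X_i^0=\varphi_i$ and $X_i^{t+1}=\psi_i$ with every $X_j$ replaced by $X_j^t$. The state of $v$ in round $t$ is $\{X_i \mid G,v\models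 X_i^t\}$; it is accepting if it contains an appointed predicate. *Floats.* A floating-point system $S$ with parameters $p\ge1$, $n\ge0$, $\beta\ge2$ consists of all rationals $\pm 0.d_1\cdots d_p\times\beta^e$ with digits $0\le d_i\le\beta-1$ and $e\in\{-n,\dots,n\}$. The operations $+$ and $\cdot$ on $S$ are the exact operations followed by rounding to the closest element of $S$, ties going to the element with an even least significant digit (if this does not decide, to the one larger in magnitude). $\mathrm{SUM}_S$ of a multiset of floats adds its elements, with multiplicity, in increasing order. *GNN[F]s.* A $\mathrm{GNN[F]}$ over $\Pi$ is given by a floating-point system $S$, a dimension $d\ge1$, an initialization $\pi\colon\mathcal P(\Pi)\to S^d$, an aggregation function $\mathrm{AGG}$ from multisets over $S^d$ to $S^d$, a combination function $\mathrm{COM}\colon S^d\times S^d\to S^d$ and a set $F\subseteq S^d$ of accepting feature vectors, such that $\mathrm{AGG}$ is bounded: for some $k\in\mathbb N$, $\mathrm{AGG}(M)=\mathrm{AGG}(M_{|k})$ for all $M$, where $M_{|k}(x)=\min\{M(x),k\}$. The state of $v$ in round $0$ is $x_v^0=\pi(\lambda(v))$ and in round $t+1$ it is $x_v^{t+1}=\mathrm{COM}\bigl(x_v^t,\mathrm{AGG}(\{\!\{x_u^t\mid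 (v,u)\in E\}\!\})\bigr)$; it is accepting if it lies in $F$. An R-simple aggregate-combine $\mathrm{GNN[F]}$ is one in which $\mathrm{AGG}$ is $\mathrm{SUM}_S$ in each coordinate and $\mathrm{COM}(x,y)=\mathrm{ReLU}^*(x\cdot C+y\cdot A+\mathbf b)$, evaluated in $S$, for some $C,A\in S^{d\times d}$ and $\mathbf b\in S^d$, where $\mathrm{ReLU}^*(z)=\min(\max(0,z),1)$ is applied to each coordinate (for these $\mathrm{AGG}$, boundedness holds automatically). *Acceptance.* Under fixed-point acceptance, a program or network accepts $(G,v)$ if there is $k\in\mathbb N$ such that the state of $v$ is accepting in every round $k'\ge k$. Under Büchi acceptance, it accepts $(G,v)$ if the state of $v$ is accepting in infinitely many rounds. Two classes of such objects have the same expressive power (under a given acceptance condition) if for every object over $\Pi$ in either class there is one over $\Pi$ in the other class that accepts exactly the same pointed $\Pi$-labeled graphs. **Theorem.** For every finite $\Pi$: under fixed-point acceptance, GMSC-programs, $\mathrm{GNN[F]}$s and R-simple aggregate-combine $\mathrm{GNN[F]}$s over $\Pi$ all have the same expressive power. The same holds under Büchi acceptance. -/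

import Mathlib

/-!
Recurrent graph neural networks over floating-point numbers, the graded modal substitution
calculus, and their fixed-point and Büchi semantics.
-/

universe u w

noncomputable section

namespace RecGNN

/-! ### Labelled graphs -/

/-- A finite directed graph (self-loops allowed) whose nodes carry sets of label symbols
from `P`. -/
structure LabeledGraph (P : Type w) where
  /-- the nodes -/
  V : Type u
  finite : Finite V
  /-- the edges -/
  E : V → V → Prop
  /-- the labelling of the nodes -/
  lab : V → Set P

attribute [instance] LabeledGraph.finite

/-- The finite set of out-neighbours of a node. -/
def LabeledGraph.outNbrs {P : Type w} (G : LabeledGraph.{u} P) (v : G.V) : Finset G.V :=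
  (Set.toFinite {x : G.V | G.E v x}).toFinset

/-! ### Graded modal logic and the graded modal substitution calculus -/

/-- Formulae of graded modal logic over the label symbols `P`; `dia k φ` is the graded diamond
"at least `k` out-neighbours satisfy `φ`". -/
inductive GML (P : Type w) : Type w
  | top : GML P
  | sym : P → GML P
  | neg : GML P → GML P
  | conj : GML P → GML P → GML P
  | dia : ℕ → GML P → GML P

/-- Truth of a formula of graded modal logic at a node of a labelled graph. -/
def GML.Sat {P : Type w} (G : LabeledGraph.{u} P) : GML P → G.V → Prop
  | .top, _ => True
  | .sym p, v => p ∈ G.lab v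
  | .neg φ, v => ¬ φ.Sat G v
  | .conj φ ψ, v => φ.Sat G v ∧ ψ.Sat G v
  | .dia k φ, v => k ≤ Set.ncard {x : G.V | G.E v x ∧ φ.Sat G x}

/-- Schemata: formulae of graded modal logic in which the schema variables from `T` may occur
as atoms. -/
inductive Schema (P : Type w) (T : Type) : Type w
  | top : Schema P T
  | sym : P → Schema P T
  | var : T → Schema P T
  | neg : Schema P T → Schema P T
  | conj : Schema P T → Schema P T → Schema P T
  | dia : ℕ → Schema P T → Schema P T

/-- Replace every schema variable `X` by the formula `σ X`. -/
def Schema.subst {P : Type w} {T : Type} (σ : T → GML P) : Schema P T → GML P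
  | .top => .top
  | .sym p => .sym p
  | .var X => σ X
  | .neg φ => .neg (φ.subst σ)
  | .conj φ ψ => .conj (φ.subst σ) (ψ.subst σ)
  | .dia k φ => .dia k (φ.subst σ)

/-- A program of the graded modal substitution calculus with head predicates
`X_0, …, X_{n-1}`. -/
structure GMSC (P : Type w) where
  /-- the number of head predicates -/
  n : ℕ
  /-- the bodies of the terminal clauses `X_i (0) :- φ_i` -/
  terminal : Fin n → GML P
  /-- the bodies of the iteration clauses `X_i :- ψ_i` -/
  iteration : Fin n → Schema P (Fin n)
  /-- the appointed predicates -/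
  appointed : Set (Fin n)

/-- The `t`-th iteration formula of the head predicate `X_i`. -/
def GMSC.iterFormula {P : Type w} (L : GMSC P) : ℕ → Fin L.n → GML P
  | 0, i => L.terminal i
  | t + 1, i => (L.iteration i).subst (L.iterFormula t)

/-- The label of a node in round `t`: the set of head predicates whose `t`-th iteration
formula is true at the node. -/
def GMSC.run {P : Type w} (L : GMSC P) (G : LabeledGraph.{u} P) (t : ℕ) (v : G.V) :
    Set (Fin L.n) :=
  {X | (L.iterFormula t X).Sat G v}

/-- The accepting labels of a program: the sets containing an appointed predicate. -/
def GMSC.accepting {P : Type w} (L : GMSC P) : Set (Set (Fin L.n)) :=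
  {Y | (L.appointed ∩ Y).Nonempty}

/-! ### Floating-point systems -/

/-- The parameters of a floating-point system: `p` digits, exponents from `-n` to `n`,
base `β`. -/
structure FloatSystem where
  p : ℕ
  n : ℕ
  β : ℕ
  p_pos : 0 < p
  two_le_β : 2 ≤ β

namespace FloatSystem

variable (S : FloatSystem)

/-- The rational `± 0.d_1 … d_p × β ^ e`, where `m = ± d_1 … d_p` is read as an integer in
base `β`. -/
def value (e m : ℤ) : ℚ := (m : ℚ) * (S.β : ℚ) ^ (e - (S.p : ℤ))

/-- The finite set of all rationals `± 0.d_1 … d_p × β ^ e` with `-n ≤ e ≤ n`. -/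
def carrier : Finset ℚ :=
  (Finset.Icc (-(S.n : ℤ)) (S.n : ℤ) ×ˢ
    Finset.Ioo (-((S.β : ℤ) ^ S.p)) ((S.β : ℤ) ^ S.p)).image fun em => S.value em.1 em.2

/-- The floats of the system. -/
abbrev Num : Type := {x : ℚ // x ∈ S.carrier}

theorem mem_carrier {x : ℚ} :
    x ∈ S.carrier ↔ ∃ e m : ℤ, -(S.n : ℤ) ≤ e ∧ e ≤ S.n ∧
      |m| < (S.β : ℤ) ^ S.p ∧ S.value e m = x := by
  simp only [carrier, Finset.mem_image, Finset.mem_product, Finset.mem_Icc, Finset.mem_Ioo,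
    Prod.exists, abs_lt]
  constructor
  · rintro ⟨e, m, ⟨⟨h1, h2⟩, h3, h4⟩, h5⟩
    exact ⟨e, m, h1, h2, ⟨h3, h4⟩, h5⟩
  · rintro ⟨e, m, h1, h2, ⟨h3, h4⟩, h5⟩
    exact ⟨e, m, ⟨⟨h1, h2⟩, h3, h4⟩, h5⟩

theorem zero_mem : (0 : ℚ) ∈ S.carrier := by
  rw [mem_carrier]
  refine ⟨0, 0, by simp, by simp, ?_, by simp [value]⟩
  have : (0 : ℤ) < S.β := by have := S.two_le_β; omega
  simpa using pow_pos this S.p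

theorem one_mem_of_one_lt {x : ℚ} (hx : x ∈ S.carrier) (h1 : 1 < x) : (1 : ℚ) ∈ S.carrier := by
  rw [mem_carrier] at hx ⊢
  obtain ⟨e, m, -, he, hm, rfl⟩ := hx
  have hβ : (1 : ℚ) < S.β := by exact_mod_cast S.two_le_β
  have hβ0 : (0 : ℚ) < S.β := by linarith
  have hmq : (m : ℚ) < (S.β : ℚ) ^ S.p := by exact_mod_cast (abs_lt.mp hm).2
  have hlt : S.value e m < (S.β : ℚ) ^ e := by
    have h2 : (S.β : ℚ) ^ e = (S.β : ℚ) ^ S.p * (S.β : ℚ) ^ (e - (S.p : ℤ)) := by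
      rw [← zpow_natCast, ← zpow_add₀ hβ0.ne']
      congr 1
      ring
    rw [value, h2]
    exact mul_lt_mul_of_pos_right hmq (zpow_pos hβ0 _)
  have he1 : 1 ≤ e := by
    by_contra hcon
    have : (S.β : ℚ) ^ e ≤ 1 := zpow_le_one_of_nonpos₀ hβ.le (by omega)
    linarith
  refine ⟨1, (S.β : ℤ) ^ (S.p - 1), by omega, by omega, ?_, ?_⟩
  · have hβz : (1 : ℤ) < S.β := by exact_mod_cast S.two_le_β
    rw [abs_of_pos (by positivity)]
    exact pow_lt_pow_right₀ hβz (by have := S.p_pos; omega)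
  · have h3 : ((S.p - 1 : ℕ) : ℤ) = (S.p : ℤ) - 1 := by have := S.p_pos; omega
    rw [value]
    push_cast
    rw [← zpow_natCast, ← zpow_add₀ hβ0.ne', h3]
    simp

/-- The least significant digit of `x` is even, where `x` is written with the smallest possible
exponent, that is, without a leading zero whenever the system permits this. -/
def LastDigitEven (x : ℚ) : Prop :=
  ∃ e m : ℤ,
    IsLeast {e' : ℤ | -(S.n : ℤ) ≤ e' ∧ e' ≤ S.n ∧
      ∃ m' : ℤ, |m'| < (S.β : ℤ) ^ S.p ∧ S.value e' m' = x} e ∧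
    S.value e m = x ∧ Even (m.natAbs % S.β)

open Classical in
/-- The key that rounding `x` minimises lexicographically over the floats `y`: first the distance
to `x`; in case of a tie, floats with an even least significant digit are preferred; if this
does not decide (which can happen only when `p = 1`, for example between `9` and `10` in
base `10`), the float that is larger in magnitude is preferred. -/
def roundKey (x y : ℚ) : ℚ ×ₗ ℕ ×ₗ ℚ :=
  toLex (|y - x|, toLex (if S.LastDigitEven y then 0 else 1, -|y|))

/-- Rounding to the closest float, ties to even. -/
def round (x : ℚ) : S.Num :=
  let h := Finset.exists_min_image S.carrier (S.roundKey x) ⟨0, S.zero_mem⟩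
  ⟨h.choose, h.choose_spec.1⟩

/-- The float `0`. -/
def zero : S.Num := ⟨0, S.zero_mem⟩

/-- Floating-point addition: the exact sum, rounded. -/
def add (x y : S.Num) : S.Num := S.round (x.1 + y.1)

/-- Floating-point multiplication: the exact product, rounded. -/
def mul (x y : S.Num) : S.Num := S.round (x.1 * y.1)

/-- The truncated rectified linear unit `min (max 0 x) 1`. -/
def reluStar (x : S.Num) : S.Num :=
  ⟨min (max 0 x.1) 1, by
    obtain ⟨x, hx⟩ := x
    rcases le_total x 0 with h0 | h0
    · simpa [h0] using S.zero_mem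
    · rcases le_or_gt x 1 with h1 | h1
      · simpa [h0, h1] using hx
      · simpa [h0, h1.le] using S.one_mem_of_one_lt hx h1⟩

/-- The sum of a multiset of floats, where the floats are added in increasing order. -/
def sum (M : Multiset S.Num) : S.Num := (M.sort (· ≤ ·)).foldl S.add S.zero

/-- The floating-point product of a row vector and a square matrix. -/
def vecMul {d : ℕ} (x : Fin d → S.Num) (C : Matrix (Fin d) (Fin d) S.Num) : Fin d → S.Num :=
  fun j => (List.finRange d).foldl (fun a i => S.add a (S.mul (x i) (C i j))) S.zero

end FloatSystem

/-! ### Recurrent graph neural networks over floats -/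

/-- The `k`-projection of a multiset: multiplicities are cut off at `k`. -/
def kProj {U : Type} [DecidableEq U] (k : ℕ) (M : Multiset U) : Multiset U :=
  ∑ a ∈ M.toFinset, Multiset.replicate (min (M.count a) k) a

theorem count_kProj {U : Type} [DecidableEq U] (k : ℕ) (M : Multiset U) (a : U) :
    (kProj k M).count a = min (M.count a) k := by
  simp only [kProj, Multiset.count_sum', Multiset.count_replicate]
  by_cases h : a ∈ M
  · simp [h]
  · simp [h]

/-- A recurrent graph neural network whose feature vectors are vectors of floats. No bound on
the aggregation function is imposed yet. -/
structure FloatGNN (P : Type w) where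
  /-- the floating-point system -/
  S : FloatSystem
  /-- the dimension of the feature vectors -/
  d : ℕ
  d_pos : 0 < d
  /-- the initialization function -/
  init : Set P → (Fin d → S.Num)
  /-- the aggregation function -/
  agg : Multiset (Fin d → S.Num) → (Fin d → S.Num)
  /-- the combination function -/
  com : (Fin d → S.Num) → (Fin d → S.Num) → (Fin d → S.Num)
  /-- the accepting feature vectors -/
  accepting : Set (Fin d → S.Num)

namespace FloatGNN

variable {P : Type w} (N : FloatGNN P)

/-- The feature vector of a node in round `t`. -/
def run (G : LabeledGraph.{u} P) : ℕ → G.V → (Fin N.d → N.S.Num)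
  | 0, v => N.init (G.lab v)
  | t + 1, v => N.com (run G t v) (N.agg ((G.outNbrs v).val.map (run G t)))

/-- `N` is a `GNN[F]`: for some `k`, the aggregation function sees only the `k`-projection of its
argument. -/
def IsGNNF : Prop := ∃ k : ℕ, ∀ M, N.agg M = N.agg (kProj k M)

/-- `N` is an R-simple aggregate-combine `GNN[F]`: aggregation is the coordinatewise sum in
increasing order, and combination is `ReLU* (x · C + y · A + b)` computed in the floating-point
system. -/
def IsRSimple : Prop :=
  (∀ M j, N.agg M j = N.S.sum (M.map fun x => x j)) ∧
  ∃ (C A : Matrix (Fin N.d) (Fin N.d) N.S.Num) (b : Fin N.d → N.S.Num),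
    ∀ x y j, N.com x y j =
      N.S.reluStar (N.S.add (N.S.add (N.S.vecMul x C j) (N.S.vecMul y A j)) (b j))

end FloatGNN

/-! ### Run classifiers and expressive power -/

/-- A classifier of the sequence of labels that a node carries in the rounds `0, 1, 2, …`, given
the set of accepting labels. -/
abbrev RunClassifier : Type 1 := ∀ X : Type, Set X → (ℕ → X) → Prop

/-- Fixed-point acceptance: from some round on, the label is always accepting. -/
def fixedPoint : RunClassifier := fun _ F r => ∃ k, ∀ k' ≥ k, r k' ∈ F

/-- Büchi acceptance: the label is accepting in infinitely many rounds. -/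
def buchi : RunClassifier := fun _ F r => {i | r i ∈ F}.Infinite

/-- A classifier of pointed labelled graphs (equivalently, a node property). -/
abbrev NodeProperty (P : Type w) := ∀ G : LabeledGraph.{u} P, G.V → Prop

/-- The classification system given by the programs of the graded modal substitution calculus
and a run classifier. -/
def gmscSystem (P : Type w) (C : RunClassifier) : Set (NodeProperty.{u} P) :=
  {Q | ∃ L : GMSC P, Q = fun G v => C _ L.accepting fun t => L.run G t v}

/-- The classification system given by the `GNN[F]`s and a run classifier. -/
def gnnfSystem (P : Type w) (C : RunClassifier) : Set (NodeProperty.{u} P) :=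
  {Q | ∃ N : FloatGNN P, N.IsGNNF ∧ Q = fun G v => C _ N.accepting fun t => N.run G t v}

/-- The classification system given by the R-simple aggregate-combine `GNN[F]`s and a run
classifier. -/
def rSimpleSystem (P : Type w) (C : RunClassifier) : Set (NodeProperty.{u} P) :=
  {Q | ∃ N : FloatGNN P, N.IsRSimple ∧ Q = fun G v => C _ N.accepting fun t => N.run G t v}

/-- Two classification systems have the same expressive power if every member of one is
equivalent, on all pointed labelled graphs, to a member of the other, and vice versa. -/
def SameExpressivePower {P : Type w} (A B : Set (NodeProperty.{u} P)) : Prop :=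
  (∀ Q ∈ A, ∃ R ∈ B, ∀ G v, Q G v ↔ R G v) ∧ (∀ R ∈ B, ∃ Q ∈ A, ∀ G v, Q G v ↔ R G v)

end RecGNN

end

noncomputable section

namespace RecGNN

/-! ### Boundedness of the floating-point sum -/

theorem sort_eq_flatMap_replicate {α : Type*} [LinearOrder α] [Fintype α]
    (M : Multiset α) :
    M.sort (· ≤ ·) =
      ((Finset.univ : Finset α).sort (· ≤ ·)).flatMap fun a => List.replicate (M.count a) a := by
  refine List.Perm.eq_of_pairwise (le := (· ≤ ·)) (fun a b _ _ => le_antisymm)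
    (Multiset.pairwise_sort _ _) ?_ ?_
  · rw [List.pairwise_flatMap]
    refine ⟨fun a _ => List.pairwise_replicate.2 (Or.inr le_rfl), ?_⟩
    refine (Finset.pairwise_sort Finset.univ (· ≤ ·)).imp fun {a b} hab x hx y hy => ?_
    rw [List.eq_of_mem_replicate hx, List.eq_of_mem_replicate hy]
    exact hab
  · rw [List.perm_iff_count]
    intro x
    have h1 : List.count x (M.sort (· ≤ ·)) = M.count x := by
      rw [← Multiset.coe_count, Multiset.sort_eq]
    rw [h1, List.count_flatMap, ← Multiset.sum_coe, ← Multiset.map_coe, Finset.sort_eq]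
    change _ = ∑ a, _
    simp [List.count_replicate]

theorem FloatSystem.abs_round_sub_le (S : FloatSystem) (x : ℚ) {y : ℚ} (hy : y ∈ S.carrier) :
    |(S.round x).1 - x| ≤ |y - x| := by
  have h := (Finset.exists_min_image S.carrier (S.roundKey x) ⟨0, S.zero_mem⟩).choose_spec.2 y hy
  rw [roundKey, roundKey, Prod.Lex.toLex_le_toLex] at h
  rcases h with h | h
  · exact h.le
  · exact h.1.le

theorem FloatSystem.round_of_mem (S : FloatSystem) {x : ℚ} (hx : x ∈ S.carrier) :
    (S.round x).1 = x := by
  have h := S.abs_round_sub_le x hx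
  simpa [sub_eq_zero] using h

theorem FloatSystem.le_add_of_nonneg (S : FloatSystem) (x a : S.Num) (ha : 0 ≤ a.1) :
    x ≤ S.add x a := by
  have h := S.abs_round_sub_le (x.1 + a.1) x.2
  change x.1 ≤ (S.round (x.1 + a.1)).1
  rw [show x.1 - (x.1 + a.1) = -a.1 by ring, abs_neg, abs_of_nonneg ha, abs_le] at h
  linarith [h.1]

theorem FloatSystem.add_le_of_nonpos (S : FloatSystem) (x a : S.Num) (ha : a.1 ≤ 0) :
    S.add x a ≤ x := by
  have h := S.abs_round_sub_le (x.1 + a.1) x.2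
  change (S.round (x.1 + a.1)).1 ≤ x.1
  rw [show x.1 - (x.1 + a.1) = -a.1 by ring, abs_neg, abs_of_nonpos ha, abs_le] at h
  linarith [h.2]

theorem FloatSystem.exists_iterate_add_stable (S : FloatSystem) :
    ∃ k : ℕ, ∀ (a x : S.Num) (m : ℕ), k ≤ m →
      (fun y => S.add y a)^[m] x = (fun y => S.add y a)^[k] x := by
  have h : ∀ ax : S.Num × S.Num, ∃ k : ℕ, ∀ m, k ≤ m →
      (fun y => S.add y ax.1)^[k] ax.2 = (fun y => S.add y ax.1)^[m] ax.2 := by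
    rintro ⟨a, x⟩
    rcases le_total 0 a.1 with ha | ha
    · exact WellFoundedGT.monotone_chain_condition
        ⟨fun m => (fun y => S.add y a)^[m] x, monotone_nat_of_le_succ fun m => by
          rw [Function.iterate_succ_apply']
          exact S.le_add_of_nonneg _ _ ha⟩
    · exact WellFoundedGT.monotone_chain_condition (α := S.Numᵒᵈ)
        ⟨fun m => OrderDual.toDual ((fun y => S.add y a)^[m] x), monotone_nat_of_le_succ fun m => by
          rw [Function.iterate_succ_apply']
          exact S.add_le_of_nonpos _ _ ha⟩
  choose k hk using h
  obtain ⟨K, hK⟩ := Finite.exists_le k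
  refine ⟨K, fun a x m hm => ?_⟩
  rw [← hk (a, x) m ((hK _).trans hm), ← hk (a, x) K (hK _)]

theorem FloatSystem.sum_eq_foldl_iterate (S : FloatSystem) (M : Multiset S.Num) :
    S.sum M = ((Finset.univ : Finset S.Num).sort (· ≤ ·)).foldl
      (fun x a => (fun y => S.add y a)^[M.count a] x) S.zero := by
  rw [sum, sort_eq_flatMap_replicate, List.foldl_flatMap]
  congr 1
  funext x a
  have h : ∀ n x, (List.replicate n a).foldl S.add x = (fun y => S.add y a)^[n] x := by
    intro n
    induction n with
    | zero => exact fun _ => rfl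
    | succ n ih =>
      intro x
      rw [List.replicate_succ, List.foldl_cons, ih, Function.iterate_succ_apply]
  convert h (M.count a) x

theorem FloatSystem.exists_sum_kProj (S : FloatSystem) :
    ∃ k : ℕ, ∀ M : Multiset S.Num, S.sum M = S.sum (kProj k M) := by
  obtain ⟨k, hk⟩ := S.exists_iterate_add_stable
  refine ⟨k, fun M => ?_⟩
  rw [sum_eq_foldl_iterate, sum_eq_foldl_iterate]
  congr 1
  funext x a
  rw [count_kProj]
  rcases le_total (M.count a) k with h | h
  · rw [min_eq_left h]
  · rw [min_eq_right h, hk a x _ h]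

theorem kProj_map_kProj {U W : Type} [DecidableEq U] [DecidableEq W] (f : U → W) (k : ℕ)
    (M : Multiset U) : kProj k ((kProj k M).map f) = kProj k (M.map f) := by
  ext b
  rw [count_kProj, count_kProj]
  by_cases h : ∀ x ∈ M, f x = b → M.count x ≤ k
  · congr 1
    rw [Multiset.count_map, Multiset.count_map]
    congr 1
    ext x
    rw [Multiset.count_filter, Multiset.count_filter, count_kProj]
    split_ifs with hx
    · rcases Nat.eq_zero_or_pos (M.count x) with h0 | h0
      · simp [h0]
      · exact min_eq_left (h x (Multiset.count_pos.1 h0) hx.symm)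
    · rfl
  · push Not at h
    obtain ⟨x, -, rfl, hx⟩ := h
    have key : ∀ N : Multiset U, k ≤ N.count x → min ((N.map f).count (f x)) k = k := by
      intro N hN
      refine min_eq_right (hN.trans ?_)
      rw [Multiset.count_map]
      refine le_trans ?_ (Multiset.count_le_card x _)
      rw [Multiset.count_filter, if_pos rfl]
    rw [key _ hx.le, key]
    rw [count_kProj, min_eq_right hx.le]

theorem FloatGNN.IsRSimple.isGNNF {P : Type w} {N : FloatGNN P} (h : N.IsRSimple) :
    N.IsGNNF := by
  obtain ⟨k, hk⟩ := N.S.exists_sum_kProj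
  refine ⟨k, fun M => funext fun j => ?_⟩
  rw [h.1, h.1, hk, ← kProj_map_kProj, ← hk]

/-! ### Semantics of schemata -/

/-- Truth of a schema at a node, where `val X` is the set of nodes at which the schema variable
`X` is true. -/
def Schema.Sat {P : Type w} {T : Type} (G : LabeledGraph.{u} P) (val : T → G.V → Prop) :
    Schema P T → G.V → Prop
  | .top, _ => True
  | .sym p, v => p ∈ G.lab v
  | .var X, v => val X v
  | .neg φ, v => ¬ φ.Sat G val v
  | .conj φ ψ, v => φ.Sat G val v ∧ ψ.Sat G val v
  | .dia k φ, v => k ≤ Set.ncard {x : G.V | G.E v x ∧ φ.Sat G val x}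

theorem Schema.sat_subst {P : Type w} {T : Type} (G : LabeledGraph.{u} P) (σ : T → GML P)
    (χ : Schema P T) (v : G.V) :
    (χ.subst σ).Sat G v ↔ χ.Sat G (fun X => (σ X).Sat G) v := by
  induction χ generalizing v with
  | top => rfl
  | sym p => rfl
  | var X => rfl
  | neg φ ih => exact not_congr (ih v)
  | conj φ ψ ih₁ ih₂ => exact and_congr (ih₁ v) (ih₂ v)
  | dia k φ ih => simp only [subst, GML.Sat, Sat, ih]

theorem GMSC.mem_run_succ {P : Type w} (L : GMSC P) (G : LabeledGraph.{u} P) (t : ℕ) (v : G.V)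
    (i : Fin L.n) :
    i ∈ L.run G (t + 1) v ↔ (L.iteration i).Sat G (fun j x => j ∈ L.run G t x) v :=
  Schema.sat_subst G _ _ v

/-- A condition on nodes, depending on a valuation of the schema variables, is definable if it
is expressed by some schema. -/
def Definable {P : Type w} {T : Type}
    (R : ∀ G : LabeledGraph.{u} P, (T → G.V → Prop) → G.V → Prop) : Prop :=
  ∃ χ : Schema P T, ∀ G val v, χ.Sat G val v ↔ R G val v

namespace Definable

variable {P : Type w} {T : Type}
  {R R' : ∀ G : LabeledGraph.{u} P, (T → G.V → Prop) → G.V → Prop}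

theorem true : Definable.{u} (P := P) (T := T) fun _ _ _ => True :=
  ⟨.top, fun _ _ _ => Iff.rfl⟩

theorem label (p : P) : Definable.{u} (P := P) (T := T) fun G _ v => p ∈ G.lab v :=
  ⟨.sym p, fun _ _ _ => Iff.rfl⟩

theorem var (X : T) : Definable.{u} (P := P) fun _ val v => val X v :=
  ⟨.var X, fun _ _ _ => Iff.rfl⟩

theorem not (h : Definable R) : Definable fun G val v => ¬ R G val v := by
  obtain ⟨χ, hχ⟩ := h
  exact ⟨.neg χ, fun G val v => not_congr (hχ G val v)⟩

theorem and (h : Definable R) (h' : Definable R') :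
    Definable fun G val v => R G val v ∧ R' G val v := by
  obtain ⟨χ, hχ⟩ := h
  obtain ⟨χ', hχ'⟩ := h'
  exact ⟨.conj χ χ', fun G val v => and_congr (hχ G val v) (hχ' G val v)⟩

theorem atLeast (k : ℕ) (h : Definable R) :
    Definable fun G val v => k ≤ Set.ncard {x : G.V | G.E v x ∧ R G val x} := by
  obtain ⟨χ, hχ⟩ := h
  exact ⟨.dia k χ, fun G val v => by simp only [Schema.Sat, hχ]⟩

theorem congr (h : Definable R) (hR : ∀ G val v, R G val v ↔ R' G val v) : Definable R' := by
  obtain ⟨χ, hχ⟩ := h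
  exact ⟨χ, fun G val v => (hχ G val v).trans (hR G val v)⟩

theorem const (p : Prop) : Definable.{u} (P := P) (T := T) fun _ _ _ => p := by
  by_cases hp : p
  · exact true.congr fun _ _ _ => by simp [hp]
  · exact true.not.congr fun _ _ _ => by simp [hp]

theorem forall_finite {ι : Type*} [Finite ι]
    {Q : ι → ∀ G : LabeledGraph.{u} P, (T → G.V → Prop) → G.V → Prop}
    (h : ∀ i, Definable (Q i)) : Definable fun G val v => ∀ i, Q i G val v := by
  classical
  have := Fintype.ofFinite ι
  have key : ∀ s : Finset ι, Definable fun G val v => ∀ i ∈ s, Q i G val v := by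
    intro s
    induction s using Finset.induction_on with
    | empty => exact true.congr fun _ _ _ => by simp
    | insert i s _ ih => exact ((h i).and ih).congr fun _ _ _ => by simp
  exact (key Finset.univ).congr fun _ _ _ => by simp

theorem exists_finite {ι : Type*} [Finite ι]
    {Q : ι → ∀ G : LabeledGraph.{u} P, (T → G.V → Prop) → G.V → Prop}
    (h : ∀ i, Definable (Q i)) : Definable fun G val v => ∃ i, Q i G val v :=
  (forall_finite fun i => (h i).not).not.congr fun _ _ _ => by simp

theorem cutoff_eq (k : ℕ) (m : Fin (k + 1)) (h : Definable R) :
    Definable fun G val v => min (Set.ncard {x : G.V | G.E v x ∧ R G val x}) k = m := by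
  rcases (Nat.lt_succ_iff.1 m.2).lt_or_eq with hm | hm
  · refine ((h.atLeast m).and (h.atLeast (m + 1)).not).congr fun G val v => ?_
    omega
  · refine (h.atLeast k).congr fun G val v => ?_
    omega

end Definable

/-! ### From networks to programs -/

theorem LabeledGraph.count_map_outNbrs {P : Type w} (G : LabeledGraph.{u} P) {U : Type}
    [DecidableEq U] (x : G.V → U) (v : G.V) (a : U) :
    ((G.outNbrs v).val.map x).count a = Set.ncard {y : G.V | G.E v y ∧ x y = a} := by
  classical
  rw [Multiset.count_map, ← Finset.filter_val, Finset.card_val, ← Set.ncard_coe_finset]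
  congr 1
  ext y
  simp [outNbrs, eq_comm]

variable {P : Type w}

theorem FloatGNN.IsGNNF.exists_gmsc [Finite P] {N : FloatGNN P} (hN : N.IsGNNF) :
    ∃ L : GMSC P, ∃ e : (Fin N.d → N.S.Num) ≃ Fin L.n,
      L.appointed = e '' N.accepting ∧
      ∀ (G : LabeledGraph.{u} P) t v, L.run G t v = {e (N.run G t v)} := by
  classical
  obtain ⟨k, hk⟩ := hN
  obtain ⟨n, ⟨e⟩⟩ := Finite.exists_equiv_fin (Fin N.d → N.S.Num)
  have hterm : ∀ q, Definable.{u} (P := P) (T := Fin n) fun G _ v => N.init (G.lab v) = q := by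
    intro q
    refine (Definable.exists_finite (ι := Set P) (Q := fun s G _ v =>
      N.init s = q ∧ ∀ p, (p ∈ G.lab v ↔ p ∈ s)) fun s => (Definable.const _).and <|
        Definable.forall_finite fun p => ?_).congr fun G _ v => ?_
    · by_cases hp : p ∈ s
      · exact (Definable.label p).congr fun _ _ _ => by simp [hp]
      · exact (Definable.label p).not.congr fun _ _ _ => by simp [hp]
    · constructor
      · rintro ⟨s, h1, h2⟩
        rwa [Set.ext h2]
      · exact fun h => ⟨_, h, fun p => Iff.rfl⟩
  have hiter : ∀ q, Definable.{u} (P := P) (T := Fin n) fun G val v =>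
      ∃ qg : (Fin N.d → N.S.Num) × ((Fin N.d → N.S.Num) → Fin (k + 1)),
        N.com qg.1 (N.agg (∑ a, Multiset.replicate (qg.2 a) a)) = q ∧
        val (e qg.1) v ∧
        ∀ a, min (Set.ncard {x : G.V | G.E v x ∧ val (e a) x}) k = qg.2 a := fun q =>
    Definable.exists_finite fun qg => (Definable.const _).and <| (Definable.var _).and <|
      Definable.forall_finite fun a => Definable.cutoff_eq k _ (Definable.var (e a))
  choose T hT using hterm
  choose I hI using hiter
  let L : GMSC P := ⟨n, fun i => (T (e.symm i)).subst fun _ => .top, fun i => I (e.symm i),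
    e '' N.accepting⟩
  refine ⟨L, e, rfl, fun G t => ?_⟩
  induction t with
  | zero =>
    intro v
    ext i
    change ((T (e.symm i)).subst fun _ => .top).Sat G v ↔ i = e (N.init (G.lab v))
    rw [Schema.sat_subst, hT]
    exact eq_comm.trans e.symm_apply_eq
  | succ t ih =>
    intro v
    have hval : ∀ a x, (e a ∈ L.run G t x) ↔ N.run G t x = a := by
      intro a x
      rw [ih x]
      exact e.injective.eq_iff.trans eq_comm
    ext i
    refine (L.mem_run_succ G t v i).trans ?_
    refine (hI (e.symm i) G _ v).trans ?_
    simp only [hval, ← LabeledGraph.count_map_outNbrs]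
    change _ ↔ i = e (N.com (N.run G t v) (N.agg ((G.outNbrs v).val.map (N.run G t))))
    have hM : ∀ M : Multiset (Fin N.d → N.S.Num), ∀ g : (Fin N.d → N.S.Num) → Fin (k + 1),
        (∀ a, min (M.count a) k = g a) → N.agg (∑ a, Multiset.replicate (g a) a) = N.agg M := by
      intro M g hg
      rw [hk M]
      congr 1
      ext a
      rw [count_kProj, hg, Multiset.count_sum']
      simp [Multiset.count_replicate]
    rw [← e.symm_apply_eq]
    constructor
    · rintro ⟨⟨q, g⟩, h1, rfl, h3⟩
      rw [← h1, hM _ g h3]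
    · intro h
      refine ⟨⟨N.run G t v, fun a => ⟨min (((G.outNbrs v).val.map (N.run G t)).count a) k,
        Nat.lt_succ_of_le (min_le_right _ _)⟩⟩, ?_, rfl, fun a => rfl⟩
      rw [hM _ _ fun a => rfl]
      exact h.symm

/-- A run classifier is invariant under stuttering if it cannot tell a run from a run that, after
some initial delay, repeats each of its labels a fixed number of times. -/
def StutterInvariant (C : RunClassifier) : Prop :=
  ∀ (X Y : Type) (F : Set X) (F' : Set Y) (r : ℕ → X) (r' : ℕ → Y) (a m : ℕ), 0 < m →
    (∀ t, r' (t + a) ∈ F' ↔ r (t / m) ∈ F) → (C X F r ↔ C Y F' r')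

theorem stutterInvariant_fixedPoint : StutterInvariant fixedPoint := by
  intro X Y F F' r r' a m hm h
  have h1 : (∀ᶠ t in Filter.atTop, r t ∈ F) ↔ ∀ᶠ t in Filter.atTop, r (t / m) ∈ F := by
    conv_lhs => rw [← Filter.map_div_atTop_eq_nat m hm]
    exact Filter.eventually_map
  have h2 : (∀ᶠ t in Filter.atTop, r' t ∈ F') ↔ ∀ᶠ t in Filter.atTop, r' (t + a) ∈ F' := by
    conv_lhs => rw [← Filter.map_add_atTop_eq_nat a]
    exact Filter.eventually_map
  simp only [h, ← h1] at h2
  exact (Filter.eventually_atTop.symm.trans h2.symm).trans Filter.eventually_atTop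

theorem stutterInvariant_buchi : StutterInvariant buchi := by
  intro X Y F F' r r' a m hm h
  have h1 : (∃ᶠ t in Filter.atTop, r t ∈ F) ↔ ∃ᶠ t in Filter.atTop, r (t / m) ∈ F := by
    conv_lhs => rw [← Filter.map_div_atTop_eq_nat m hm]
    exact Filter.frequently_map
  have h2 : (∃ᶠ t in Filter.atTop, r' t ∈ F') ↔ ∃ᶠ t in Filter.atTop, r' (t + a) ∈ F' := by
    conv_lhs => rw [← Filter.map_add_atTop_eq_nat a]
    exact Filter.frequently_map
  simp only [h, ← h1] at h2
  exact (Nat.frequently_atTop_iff_infinite.symm.trans h2.symm).trans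
    Nat.frequently_atTop_iff_infinite

theorem gnnfSystem_subset_gmscSystem [Finite P] {C : RunClassifier} (hC : StutterInvariant C) :
    gnnfSystem.{u} P C ⊆ gmscSystem P C := by
  rintro _ ⟨N, hN, rfl⟩
  obtain ⟨L, e, hL, hrun⟩ := FloatGNN.IsGNNF.exists_gmsc.{u} hN
  refine ⟨L, funext fun G => funext fun v => propext ?_⟩
  refine (hC _ _ _ _ _ _ 0 1 one_pos fun t => ?_)
  rw [Nat.div_one, Nat.add_zero]
  change (L.appointed ∩ L.run G t v).Nonempty ↔ _
  rw [hrun, hL, Set.inter_singleton_nonempty,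
    e.injective.mem_set_image]

open Classical in
/-- The truth value `0` or `1` of a proposition. -/
def bit (p : Prop) : ℤ := if p then 1 else 0

theorem bit_eq_zero_or_one (p : Prop) : bit p = 0 ∨ bit p = 1 := by
  unfold bit
  split_ifs <;> simp

theorem abs_bit_le_one (p : Prop) : |bit p| ≤ 1 := by
  rcases bit_eq_zero_or_one p with h | h <;> simp [h]

@[simp]
theorem bit_eq_one {p : Prop} : bit p = 1 ↔ p := by
  unfold bit
  split_ifs with h <;> simp [h]

/-! ### Integer arithmetic in floating-point systems -/

/-- The binary floating-point system with `p` digits and exponents from `-p` to `p`. The integers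
that it contains are those of absolute value less than `2 ^ p`, and it has no larger elements. -/
def FloatSystem.binary (p : ℕ) (hp : 0 < p) : FloatSystem := ⟨p, p, 2, hp, le_rfl⟩

namespace FloatSystem

variable {p : ℕ} {hp : 0 < p}

theorem intCast_mem_binary {z : ℤ} (hz : |z| < 2 ^ p) : (z : ℚ) ∈ (binary p hp).carrier :=
  (mem_carrier _).2 ⟨p, z, by simp [binary], le_rfl, hz, by simp [value, binary]⟩

theorem le_of_mem_binary {x : ℚ} (hx : x ∈ (binary p hp).carrier) : x ≤ 2 ^ p - 1 := by
  obtain ⟨e, m, -, he, hm, rfl⟩ := (mem_carrier _).1 hx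
  have hm' : |m| ≤ 2 ^ p - 1 := Int.le_sub_one_of_lt hm
  have hm'' : |(m : ℚ)| ≤ 2 ^ p - 1 := by exact_mod_cast hm'
  have he' : (2 : ℚ) ^ (e - (p : ℤ)) ≤ 1 :=
    zpow_le_one_of_nonpos₀ one_le_two (sub_nonpos.2 he)
  have he0 : (0 : ℚ) < (2 : ℚ) ^ (e - (p : ℤ)) := zpow_pos two_pos _
  calc (m : ℚ) * (2 : ℚ) ^ (e - (p : ℤ)) ≤ |(m : ℚ)| * (2 : ℚ) ^ (e - (p : ℤ)) :=
        mul_le_mul_of_nonneg_right (le_abs_self _) he0.le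
    _ ≤ |(m : ℚ)| * 1 := mul_le_mul_of_nonneg_left he' (abs_nonneg _)
    _ ≤ 2 ^ p - 1 := by linarith

theorem round_intCast {z : ℤ} (hz : |z| < 2 ^ p) : ((binary p hp).round z).1 = z :=
  round_of_mem _ (intCast_mem_binary hz)

theorem round_two_pow : ((binary p hp).round (2 ^ p)).1 = 2 ^ p - 1 := by
  have hmem : ((2 ^ p - 1 : ℤ) : ℚ) ∈ (binary p hp).carrier := by
    refine intCast_mem_binary ?_
    rw [abs_of_nonneg] <;> linarith [one_le_pow₀ (one_le_two (α := ℤ)) (n := p)]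
  have h := (binary p hp).abs_round_sub_le (2 ^ p) hmem
  have h' := le_of_mem_binary ((binary p hp).round (2 ^ p)).2
  push_cast at h
  rw [show (2 : ℚ) ^ p - 1 - 2 ^ p = -1 by ring, abs_neg, abs_one, abs_le] at h
  linarith [h.1]

theorem add_intCast {x y : (binary p hp).Num} {a b : ℤ} (hx : x.1 = a) (hy : y.1 = b)
    (h : |a + b| < 2 ^ p) : ((binary p hp).add x y).1 = ((a + b : ℤ) : ℚ) := by
  rw [add, hx, hy, ← Int.cast_add, round_intCast h]

theorem mul_intCast {x y : (binary p hp).Num} {a b : ℤ} (hx : x.1 = a) (hy : y.1 = b)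
    (h : |a * b| < 2 ^ p) : ((binary p hp).mul x y).1 = ((a * b : ℤ) : ℚ) := by
  rw [mul, hx, hy, ← Int.cast_mul, round_intCast h]

theorem foldl_add_intCast {ι : Type*} (l : List ι) (f : ι → (binary p hp).Num) (z : ι → ℤ)
    (hf : ∀ i ∈ l, (f i).1 = z i) (x : (binary p hp).Num) (a : ℤ) (hx : x.1 = a)
    (h : |a| + (l.map fun i => |z i|).sum < 2 ^ p) :
    (l.foldl (fun y i => (binary p hp).add y (f i)) x).1 = ((a + (l.map z).sum : ℤ) : ℚ) := by
  induction l generalizing x a with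
  | nil => simpa using hx
  | cons i l ih =>
    simp only [List.map_cons, List.sum_cons] at h
    have h0 : 0 ≤ (l.map fun i => |z i|).sum :=
      List.sum_nonneg fun y hy => by
        obtain ⟨j, -, rfl⟩ := List.mem_map.1 hy
        exact abs_nonneg _
    have h1 := abs_add_le a (z i)
    rw [List.foldl_cons, ih (fun j hj => hf j (List.mem_cons_of_mem _ hj)) _ (a + z i)
      (add_intCast hx (hf i List.mem_cons_self) (by linarith)) (by linarith)]
    simp [add_assoc]

theorem vecMul_intCast {d : ℕ} {x : Fin d → (binary p hp).Num}
    {C : Matrix (Fin d) (Fin d) (binary p hp).Num} {a : Fin d → ℤ} {c : Fin d → ℤ} {j : Fin d}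
    (hx : ∀ i, (x i).1 = a i) (hC : ∀ i, (C i j).1 = c i) (h : ∑ i, |a i * c i| < 2 ^ p) :
    ((binary p hp).vecMul x C j).1 = ((∑ i, a i * c i : ℤ) : ℚ) := by
  have hmul : ∀ i, ((binary p hp).mul (x i) (C i j)).1 = ((a i * c i : ℤ) : ℚ) := fun i =>
    mul_intCast (hx i) (hC i) <| lt_of_le_of_lt
      (Finset.single_le_sum (f := fun i => |a i * c i|) (fun i _ => abs_nonneg _)
        (Finset.mem_univ i)) h
  rw [vecMul, foldl_add_intCast (List.finRange d) _ _ (fun i _ => hmul i) _ 0 (by simp [zero])]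
  · simp [List.sum_ofFn, ← List.ofFn_eq_map]
  · simpa [List.sum_ofFn, ← List.ofFn_eq_map] using h

theorem reluStar_intCast {S : FloatSystem} {x : S.Num} {z : ℤ} (hx : x.1 = z) :
    (S.reluStar x).1 = bit (1 ≤ z) := by
  change min (max 0 x.1) 1 = _
  rw [hx, bit]
  split_ifs with h
  · have : (1 : ℚ) ≤ z := by exact_mod_cast h
    rw [max_eq_right (by linarith), min_eq_right this, Int.cast_one]
  · have : (z : ℚ) ≤ 0 := by exact_mod_cast Int.lt_add_one_iff.1 (not_le.1 h)
    rw [max_eq_left this, min_eq_left zero_le_one, Int.cast_zero]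

theorem foldl_add_bit (l : List (binary p hp).Num) (hl : ∀ y ∈ l, y.1 = 0 ∨ y.1 = 1)
    (x : (binary p hp).Num) (a : ℤ) (ha : 0 ≤ a) (ha' : a ≤ 2 ^ p - 1) (hx : x.1 = a) :
    (l.foldl (binary p hp).add x).1 =
      ((min (a + l.countP fun y => y.1 = 1) (2 ^ p - 1) : ℤ) : ℚ) := by
  induction l generalizing x a with
  | nil => simpa [ha'] using hx
  | cons y l ih =>
    have hl' : ∀ y ∈ l, y.1 = 0 ∨ y.1 = 1 := fun z hz => hl z (List.mem_cons_of_mem _ hz)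
    rw [List.foldl_cons]
    rcases hl y List.mem_cons_self with hy | hy
    · rw [ih hl' _ a ha ha', List.countP_cons_of_neg (by simp [hy])]
      rw [add_intCast hx (b := 0) (by simpa using hy), add_zero]
      rw [add_zero, abs_of_nonneg ha]
      linarith
    · rw [List.countP_cons_of_pos (by simp [hy])]
      push_cast
      rcases ha'.lt_or_eq with hlt | heq
      · rw [ih hl' _ (a + 1) (by linarith) (by linarith)
          (add_intCast hx (by simpa using hy) (by rw [abs_of_nonneg] <;> linarith))]
        push_cast
        ring_nf
      · rw [ih hl' _ a ha ha']
        · subst heq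
          have h0 : (0 : ℤ) ≤ l.countP fun y => y.1 = 1 := Int.natCast_nonneg _
          rw [min_eq_right (by linarith)]
          rw [min_eq_right]
          · push_cast; rfl
          · have : (0 : ℚ) ≤ l.countP fun y => y.1 = 1 := Nat.cast_nonneg _
            push_cast
            linarith
        · rw [add, hx, hy, heq]
          push_cast
          rw [sub_add_cancel, round_two_pow]

theorem sum_bit (M : Multiset (binary p hp).Num) (hM : ∀ y ∈ M, y.1 = 0 ∨ y.1 = 1) :
    ((binary p hp).sum M).1 =
      ((min (M.countP fun y => y.1 = 1 : ℤ) (2 ^ p - 1) : ℤ) : ℚ) := by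
  rw [sum, foldl_add_bit _ (fun y hy => hM y ((Multiset.mem_sort _).1 hy)) _ 0 le_rfl
    (by linarith [one_le_pow₀ (one_le_two (α := ℤ)) (n := p)]) (by simp [zero])]
  rw [zero_add, ← Multiset.coe_countP, Multiset.sort_eq]

end FloatSystem

/-! ### Threshold networks -/

/-- The update rule of a Boolean feature: either a threshold on a linear combination of the
features of the node itself, or the condition that more than `k` out-neighbours have a given
feature. -/
inductive ThresholdRule (I : Type) : Type
  | lin (c : I → ℤ) (b : ℤ) : ThresholdRule I
  | dia (k : ℕ) (j : I) : ThresholdRule I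

/-- Truth of a rule at a node, where `a j` says that the node has the feature `j`, and `n j` is the
number of its out-neighbours with the feature `j`. -/
def ThresholdRule.Holds {I : Type} [Fintype I] (a : I → Prop) (n : I → ℕ) :
    ThresholdRule I → Prop
  | lin c b => 1 ≤ ∑ j, bit (a j) * c j + b
  | dia k j => k < n j

/-- A recurrent network with Boolean features indexed by `I`. -/
structure ThresholdNetwork (P : Type w) (I : Type) where
  /-- the features in round `0` -/
  init : Set P → I → Prop
  /-- the update rules -/
  rule : I → ThresholdRule I

/-- `A.run G t i v` says that the node `v` has the feature `i` in round `t`. -/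
def ThresholdNetwork.run {P : Type w} {I : Type} [Fintype I] (A : ThresholdNetwork P I)
    (G : LabeledGraph.{u} P) : ℕ → I → G.V → Prop
  | 0, i, v => A.init (G.lab v) i
  | t + 1, i, v => (A.rule i).Holds (fun j => A.run G t j v)
      fun j => Set.ncard {x : G.V | G.E v x ∧ A.run G t j x}

namespace ThresholdRule

variable {I : Type}

/-- The coefficients of the features of the node itself. -/
def coeff : ThresholdRule I → I → ℤ
  | lin c _ => c
  | dia _ _ => 0

open Classical in
/-- The coefficients of the numbers of out-neighbours with a feature. -/
def nbrCoeff : ThresholdRule I → I → ℤ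
  | lin _ _ => 0
  | dia _ j => Pi.single j 1

/-- The constant term. -/
def bias : ThresholdRule I → ℤ
  | lin _ b => b
  | dia k _ => -k

/-- A bound on the integers that are needed to evaluate a rule. -/
def weight [Fintype I] : ThresholdRule I → ℤ
  | lin c b => ∑ j, |c j| + |b|
  | dia k _ => k + 1

end ThresholdRule

section toFloatGNN

variable {P : Type w} {I : Type} [Fintype I]

theorem abs_nbrCoeff_le_one {I : Type} (r : ThresholdRule I) (i : I) : |r.nbrCoeff i| ≤ 1 := by
  classical
  cases r with
  | lin c b => simp [ThresholdRule.nbrCoeff]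
  | dia k j =>
    rw [ThresholdRule.nbrCoeff, Pi.single_apply]
    split_ifs <;> simp

theorem abs_coeff_le_weight (r : ThresholdRule I) (i : I) : |r.coeff i| ≤ r.weight := by
  cases r with
  | lin c b =>
    exact (Finset.single_le_sum (f := fun j => |c j|) (fun j _ => abs_nonneg _)
      (Finset.mem_univ i)).trans (le_add_of_nonneg_right (abs_nonneg _))
  | dia k j =>
    simp only [ThresholdRule.coeff, ThresholdRule.weight, Pi.zero_apply, abs_zero]
    positivity

theorem abs_bias_le_weight (r : ThresholdRule I) : |r.bias| ≤ r.weight := by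
  cases r with
  | lin c b => exact le_add_of_nonneg_left (Finset.sum_nonneg fun j _ => abs_nonneg _)
  | dia k j => simp [ThresholdRule.bias, ThresholdRule.weight]

/-- A binary floating-point system with sufficiently many digits evaluates a rule correctly by
`ReLU* (x · C + y · A + b)`. -/
theorem ThresholdRule.eval_binary {p : ℕ} {hp : 0 < p} {d : ℕ} (e : I ≃ Fin d)
    (r : ThresholdRule I) (hr : r.weight < 2 ^ p)
    {x y : Fin d → (FloatSystem.binary p hp).Num}
    {C A : Matrix (Fin d) (Fin d) (FloatSystem.binary p hp).Num} {j : Fin d}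
    {b : (FloatSystem.binary p hp).Num} {a : I → Prop} {n : I → ℕ}
    (hx : ∀ i, (x (e i)).1 = bit (a i)) (hy : ∀ i, (y (e i)).1 = (min (n i : ℤ) (2 ^ p - 1) : ℤ))
    (hC : ∀ i, (C (e i) j).1 = r.coeff i) (hA : ∀ i, (A (e i) j).1 = r.nbrCoeff i)
    (hb : b.1 = r.bias) :
    ((FloatSystem.binary p hp).reluStar ((FloatSystem.binary p hp).add
      ((FloatSystem.binary p hp).add ((FloatSystem.binary p hp).vecMul x C j)
        ((FloatSystem.binary p hp).vecMul y A j)) b)).1 =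
      bit (r.Holds a n) := by
  classical
  have hp1 : (1 : ℤ) ≤ 2 ^ p := one_le_pow₀ one_le_two
  have hx' : ∀ i, (x i).1 = bit (a (e.symm i)) := fun i => by rw [← hx, e.apply_symm_apply]
  have hy' : ∀ i, (y i).1 = (min (n (e.symm i) : ℤ) (2 ^ p - 1) : ℤ) := fun i => by
    rw [← hy, e.apply_symm_apply]
  have hC' : ∀ i, (C i j).1 = r.coeff (e.symm i) := fun i => by rw [← hC, e.apply_symm_apply]
  have hA' : ∀ i, (A i j).1 = r.nbrCoeff (e.symm i) := fun i => by rw [← hA, e.apply_symm_apply]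
  cases r with
  | lin c b' =>
    change ∑ i, |c i| + |b'| < 2 ^ p at hr
    change b.1 = b' at hb
    simp only [ThresholdRule.coeff, ThresholdRule.nbrCoeff, Pi.zero_apply] at hC' hA'
    have hsum : ∑ i, |bit (a i) * c i| ≤ ∑ i, |c i| := Finset.sum_le_sum fun i _ => by
      rw [abs_mul]
      exact mul_le_of_le_one_left (abs_nonneg _) (abs_bit_le_one _)
    have hb0 := abs_nonneg b'
    have h1 := FloatSystem.vecMul_intCast (x := x) (C := C) (j := j) hx' hC' (by
      rw [e.symm.sum_comp fun i => |bit (a i) * c i|]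
      linarith)
    have h2 := FloatSystem.vecMul_intCast (x := y) (C := A) (j := j) hy' hA' (by simp)
    rw [e.symm.sum_comp fun i => bit (a i) * c i] at h1
    have habs := Finset.abs_sum_le_sum_abs (fun i => bit (a i) * c i) Finset.univ
    have h3 := FloatSystem.add_intCast h1 h2 (by
      simp only [mul_zero, Finset.sum_const_zero, add_zero]
      linarith)
    simp only [mul_zero, Finset.sum_const_zero, add_zero] at h3
    have h4 := FloatSystem.add_intCast h3 hb (by
      have := abs_add_le (∑ i, bit (a i) * c i) b'
      linarith)
    exact FloatSystem.reluStar_intCast h4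
  | dia k i =>
    change (k : ℤ) + 1 < 2 ^ p at hr
    change b.1 = (-k : ℤ) at hb
    simp only [ThresholdRule.coeff, ThresholdRule.nbrCoeff, Pi.zero_apply] at hC' hA'
    have hn : 0 ≤ min (n i : ℤ) (2 ^ p - 1) := le_min (Int.natCast_nonneg _) (by linarith)
    have hn' : min (n i : ℤ) (2 ^ p - 1) ≤ 2 ^ p - 1 := min_le_right _ _
    have h1 := FloatSystem.vecMul_intCast (x := x) (C := C) (j := j) hx' hC' (by simp)
    have h2 := FloatSystem.vecMul_intCast (x := y) (C := A) (j := j) hy' hA' (by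
      rw [e.symm.sum_comp fun i' =>
        |min (n i' : ℤ) (2 ^ p - 1) * (Pi.single i 1 : I → ℤ) i'|]
      simp only [Pi.single_apply, apply_ite abs, abs_zero, mul_ite, mul_one,
        mul_zero, Finset.sum_ite_eq', Finset.mem_univ, if_true, abs_of_nonneg hn]
      linarith)
    rw [e.symm.sum_comp fun i' => min (n i' : ℤ) (2 ^ p - 1) * (Pi.single i 1 : I → ℤ) i'] at h2
    simp only [Pi.single_apply, mul_ite, mul_one, mul_zero, Finset.sum_ite_eq', Finset.mem_univ,
      if_true] at h2
    have h3 := FloatSystem.add_intCast h1 h2 (by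
      simp only [mul_zero, Finset.sum_const_zero, zero_add, abs_of_nonneg hn]
      linarith)
    simp only [mul_zero, Finset.sum_const_zero, zero_add] at h3
    have h4 := FloatSystem.add_intCast h3 hb (by
      rw [abs_lt]
      constructor <;> linarith)
    have hiff : (1 ≤ min (n i : ℤ) (2 ^ p - 1) + -(k : ℤ)) ↔ k < n i := by
      rw [← sub_eq_add_neg, le_sub_iff_add_le, le_min_iff]
      constructor
      · rintro ⟨h, -⟩
        omega
      · intro h
        exact ⟨by omega, by linarith⟩
    rw [FloatSystem.reluStar_intCast h4, hiff, ThresholdRule.Holds]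

theorem ThresholdNetwork.exists_rSimple [Nonempty I] (A : ThresholdNetwork P I)
    (acc : Set (I → Prop)) :
    ∃ N : FloatGNN P, N.IsRSimple ∧ ∀ (G : LabeledGraph.{u} P) (t : ℕ) (v : G.V),
      N.run G t v ∈ N.accepting ↔ (fun i => A.run G t i v) ∈ acc := by
  classical
  obtain ⟨M, hM⟩ := Finite.exists_le fun i => (A.rule i).weight
  obtain ⟨p, hp, hMp⟩ : ∃ p : ℕ, 0 < p ∧ M < 2 ^ p := by
    refine ⟨M.toNat + 1, Nat.succ_pos _, (Int.self_le_toNat M).trans_lt ?_⟩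
    exact_mod_cast Nat.lt_two_pow_self.trans (Nat.pow_lt_pow_right one_lt_two (Nat.lt_succ_self _))
  have hw : ∀ i, (A.rule i).weight < 2 ^ p := fun i => (hM i).trans_lt hMp
  let S := FloatSystem.binary p hp
  let e : I ≃ Fin (Fintype.card I) := Fintype.equivFin I
  let b : Fin (Fintype.card I) → S.Num := fun j => S.round (A.rule (e.symm j)).bias
  let C : Matrix (Fin (Fintype.card I)) (Fin (Fintype.card I)) S.Num :=
    fun i j => S.round ((A.rule (e.symm j)).coeff (e.symm i))
  let D : Matrix (Fin (Fintype.card I)) (Fin (Fintype.card I)) S.Num :=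
    fun i j => S.round ((A.rule (e.symm j)).nbrCoeff (e.symm i))
  let N : FloatGNN P :=
    { S := S
      d := Fintype.card I
      d_pos := Fintype.card_pos
      init := fun s j => S.round (bit (A.init s (e.symm j)))
      agg := fun M j => S.sum (M.map fun x => x j)
      com := fun x y j =>
        S.reluStar (S.add (S.add (S.vecMul x C j) (S.vecMul y D j)) (b j))
      accepting := {x | (fun i => (x (e i)).1 = 1) ∈ acc} }
  have hone : (1 : ℤ) < 2 ^ p := one_lt_pow₀ one_lt_two hp.ne'
  have hrun : ∀ (G : LabeledGraph.{u} P) t v i, (N.run G t v (e i)).1 = bit (A.run G t i v) := by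
    intro G t
    induction t with
    | zero =>
      intro v i
      refine (FloatSystem.round_intCast ((abs_bit_le_one _).trans_lt hone)).trans ?_
      rw [e.symm_apply_apply, ThresholdNetwork.run]
    | succ t ih =>
      intro v i
      rw [ThresholdNetwork.run]
      refine ThresholdRule.eval_binary e (A.rule i) (hw i) (a := fun i => A.run G t i v)
        (n := fun i => Set.ncard {x : G.V | G.E v x ∧ A.run G t i x}) (fun i => ih v i)
        (fun i' => ?_) (fun i' => ?_) (fun i' => ?_) ?_
      · change (S.sum (((G.outNbrs v).val.map (N.run G t)).map fun x => x (e i'))).1 = _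
        rw [FloatSystem.sum_bit]
        · rw [Multiset.map_map, Multiset.countP_map, ← Finset.filter_val, Finset.card_val,
            ← Set.ncard_coe_finset]
          congr 5
          ext x
          simp [LabeledGraph.outNbrs, ih]
        · intro y hy
          rw [Multiset.map_map] at hy
          obtain ⟨x, -, rfl⟩ := Multiset.mem_map.1 hy
          rw [Function.comp_apply, ih]
          exact_mod_cast bit_eq_zero_or_one _
      · refine (FloatSystem.round_intCast ?_).trans ?_
        · exact (abs_coeff_le_weight _ _).trans_lt (hw _)
        · rw [e.symm_apply_apply, e.symm_apply_apply]
      · refine (FloatSystem.round_intCast ?_).trans ?_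
        · exact (abs_nbrCoeff_le_one _ _).trans_lt hone
        · rw [e.symm_apply_apply, e.symm_apply_apply]
      · refine (FloatSystem.round_intCast ?_).trans ?_
        · exact (abs_bias_le_weight _).trans_lt (hw _)
        · rw [e.symm_apply_apply]
  refine ⟨N, ⟨fun M j => rfl, C, D, b, fun x y j => rfl⟩, fun G t v => ?_⟩
  change (fun i => (N.run G t v (e i)).1 = 1) ∈ acc ↔ _
  simp only [hrun, Int.cast_eq_one, bit_eq_one]

end toFloatGNN

/-! ### From programs to networks -/

namespace Schema

variable {P : Type w} {T T' : Type}

/-- Rename the schema variables. -/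
def rename (f : T → T') : Schema P T → Schema P T'
  | .top => .top
  | .sym p => .sym p
  | .var X => .var (f X)
  | .neg φ => .neg (φ.rename f)
  | .conj φ ψ => .conj (φ.rename f) (ψ.rename f)
  | .dia k φ => .dia k (φ.rename f)

theorem sat_rename (G : LabeledGraph.{u} P) (f : T → T') (val : T' → G.V → Prop)
    (χ : Schema P T) (v : G.V) :
    (χ.rename f).Sat G val v ↔ χ.Sat G (fun X => val (f X)) v := by
  induction χ generalizing v with
  | top => rfl
  | sym p => rfl
  | var X => rfl
  | neg φ ih => exact not_congr (ih v)
  | conj φ ψ ih₁ ih₂ => exact and_congr (ih₁ v) (ih₂ v)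
  | dia k φ ih => simp only [rename, Sat, ih]

/-- The set of subschemata. -/
def sub : Schema P T → Set (Schema P T)
  | .top => {.top}
  | .sym p => {.sym p}
  | .var X => {.var X}
  | .neg φ => insert (.neg φ) φ.sub
  | .conj φ ψ => insert (.conj φ ψ) (φ.sub ∪ ψ.sub)
  | .dia k φ => insert (.dia k φ) φ.sub

theorem self_mem_sub (χ : Schema P T) : χ ∈ χ.sub := by
  cases χ <;> simp [sub]

theorem finite_sub (χ : Schema P T) : χ.sub.Finite := by
  induction χ with
  | top => exact Set.finite_singleton _
  | sym p => exact Set.finite_singleton _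
  | var X => exact Set.finite_singleton _
  | neg φ ih => exact ih.insert _
  | conj φ ψ ih₁ ih₂ => exact (ih₁.union ih₂).insert _
  | dia k φ ih => exact ih.insert _

theorem sub_subset_sub {φ χ : Schema P T} (h : φ ∈ χ.sub) : φ.sub ⊆ χ.sub := by
  induction χ with
  | top => rw [Set.mem_singleton_iff.1 h]
  | sym p => rw [Set.mem_singleton_iff.1 h]
  | var X => rw [Set.mem_singleton_iff.1 h]
  | neg χ ih =>
    rcases h with rfl | h
    · exact subset_rfl
    · exact (ih h).trans (Set.subset_insert _ _)
  | conj χ χ' ih₁ ih₂ =>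
    rcases h with rfl | h | h
    · exact subset_rfl
    · exact (ih₁ h).trans (Set.subset_union_left.trans (Set.subset_insert _ _))
    · exact (ih₂ h).trans (Set.subset_union_right.trans (Set.subset_insert _ _))
  | dia k χ ih =>
    rcases h with rfl | h
    · exact subset_rfl
    · exact (ih h).trans (Set.subset_insert _ _)

/-- The number of rounds that it takes to evaluate a schema when the variables are constant. -/
def height : Schema P T → ℕ
  | .top => 1
  | .sym _ => 0
  | .var _ => 1
  | .neg φ => φ.height + 1
  | .conj φ ψ => max φ.height ψ.height + 1
  | .dia _ φ => φ.height + 1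

/-- The iteration of a system of schemata, one for each variable, from the valuation in which all
variables are false. -/
def iterate (ψ : T → Schema P T) (G : LabeledGraph.{u} P) : ℕ → T → G.V → Prop
  | 0 => fun _ _ => False
  | t + 1 => fun X => (ψ X).Sat G (iterate ψ G t)

end Schema

/-- A formula as a schema without variables. -/
def GML.toSchema {P : Type w} {T : Type} : GML P → Schema P T
  | .top => .top
  | .sym p => .sym p
  | .neg φ => .neg φ.toSchema
  | .conj φ ψ => .conj φ.toSchema ψ.toSchema
  | .dia k φ => .dia k φ.toSchema

theorem GML.sat_toSchema {P : Type w} {T : Type} (G : LabeledGraph.{u} P)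
    (val : T → G.V → Prop) (φ : GML P) (v : G.V) : φ.toSchema.Sat G val v ↔ φ.Sat G v := by
  induction φ generalizing v with
  | top => rfl
  | sym p => rfl
  | neg φ ih => exact not_congr (ih v)
  | conj φ ψ ih₁ ih₂ => exact and_congr (ih₁ v) (ih₂ v)
  | dia k φ ih => simp only [toSchema, Schema.Sat, Sat, ih]

/-- The schemata that run a program from the empty valuation: the variable `none` says that the
first round is over. -/
def GMSC.delayed {P : Type w} (L : GMSC P) : Option (Fin L.n) → Schema P (Option (Fin L.n))
  | none => .top
  | some i => .conj (.neg (.conj (.var none) (.neg ((L.iteration i).rename some))))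
      (.neg (.conj (.neg (.var none)) (.neg (L.terminal i).toSchema)))

theorem GMSC.iterate_delayed {P : Type w} (L : GMSC P) (G : LabeledGraph.{u} P) (t : ℕ)
    (v : G.V) (i : Fin L.n) :
    Schema.iterate L.delayed G (t + 1) (some i) v ↔ i ∈ L.run G t v := by
  induction t generalizing v i with
  | zero =>
    simp only [Schema.iterate, delayed, Schema.Sat, GML.sat_toSchema, GMSC.run, iterFormula,
      Set.mem_ofPred_eq]
    tauto
  | succ t ih =>
    have hsome : (fun X => Schema.iterate L.delayed G (t + 1) (some X)) =
        fun j x => j ∈ L.run G t x := funext fun j => funext fun x => propext (ih x j)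
    have hnone : Schema.iterate L.delayed G (t + 1) none v := trivial
    rw [L.mem_run_succ, ← hsome, ← Schema.sat_rename, Schema.iterate]
    simp only [delayed, Schema.Sat]
    tauto

section network

variable {P : Type w} {T J : Type} [Fintype T] [Fintype J] [Nonempty J]

open Classical in
/-- The rule that updates the truth value of a schema, where `pos φ` is the feature for the truth
value of `φ`, and the value of a variable `X` is stored in two features `latch X`. -/
def Schema.rule {I : Type} (pos : Schema P T → I) (latch : T → Bool → I) :
    Schema P T → ThresholdRule I
  | .top => .lin 0 1
  | .sym p => .lin (Pi.single (pos (.sym p)) 1) 0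
  | .var X => .lin (Pi.single (latch X true) 1 + Pi.single (latch X false) 1) 0
  | .neg φ => .lin (-Pi.single (pos φ) 1) 1
  | .conj φ ψ => .lin (Pi.single (pos φ) 1 + Pi.single (pos ψ) 1) (-1)
  | .dia 0 _ => .lin 0 1
  | .dia (k + 1) φ => .dia k (pos φ)

/-- The feature for the truth value of a schema. -/
def schemaPos (nodes : J → Schema P T) (m : ℕ) (φ : Schema P T) :
    J ⊕ (T × Bool) ⊕ ZMod (m + 1) :=
  Sum.inl (Function.invFun nodes φ)

/-- The features for the value of a variable: at most one of them is present. The feature with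
index `true` says that the value has just been computed, the other one that it is older. -/
def schemaLatch (m : ℕ) (X : T) (c : Bool) : J ⊕ (T × Bool) ⊕ ZMod (m + 1) :=
  Sum.inr (Sum.inl (X, c))

/-- The features for a clock that counts the rounds modulo `m + 1`. -/
def schemaClock (m : ℕ) (j : ZMod (m + 1)) : J ⊕ (T × Bool) ⊕ ZMod (m + 1) :=
  Sum.inr (Sum.inr j)

open Classical in
/-- The network that takes `m + 1` rounds to carry out one iteration of a system of schemata, by
evaluating all the schemata in `nodes`. -/
def schemaNetwork (ψ : T → Schema P T) (nodes : J → Schema P T) (m : ℕ) :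
    ThresholdNetwork P (J ⊕ (T × Bool) ⊕ ZMod (m + 1)) where
  init s
    | Sum.inl j => ∃ p ∈ s, nodes j = .sym p
    | Sum.inr (Sum.inl _) => False
    | Sum.inr (Sum.inr j) => 0 = j
  rule
    | Sum.inl j => (nodes j).rule (schemaPos nodes m) (schemaLatch m)
    | Sum.inr (Sum.inl (X, true)) =>
      .lin (Pi.single (schemaPos nodes m (ψ X)) 1 + Pi.single (schemaClock m m) 1) (-1)
    | Sum.inr (Sum.inl (X, false)) =>
      .lin (Pi.single (schemaLatch m X true) 1 + Pi.single (schemaLatch m X false) 1 +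
        -Pi.single (schemaClock m m) 1) 0
    | Sum.inr (Sum.inr j) => .lin (Pi.single (schemaClock m (j - 1)) 1) 0

theorem sum_bit_mul_single {I : Type} [Fintype I] [DecidableEq I] (a : I → Prop) (i : I) :
    ∑ j, bit (a j) * (Pi.single i 1 : I → ℤ) j = bit (a i) := by
  simp [Pi.single_apply]

theorem one_le_bit {p : Prop} : 1 ≤ bit p ↔ p := by
  unfold bit
  split_ifs with h <;> simp [h]

theorem one_le_neg_bit_add_one {p : Prop} : 1 ≤ -bit p + 1 ↔ ¬ p := by
  unfold bit
  split_ifs with h <;> simp [h]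

theorem one_le_bit_add_bit {p q : Prop} : 1 ≤ bit p + bit q ↔ p ∨ q := by
  unfold bit
  split_ifs with h h' h' <;> simp [h, h']

theorem one_le_bit_add_bit_sub_one {p q : Prop} : 1 ≤ bit p + bit q + -1 ↔ p ∧ q := by
  unfold bit
  split_ifs with h h' h' <;> simp [h, h']

theorem one_le_bit_add_bit_sub_bit {p q r : Prop} (hpq : ¬ (p ∧ q)) :
    1 ≤ bit p + bit q + -bit r ↔ (p ∨ q) ∧ ¬ r := by
  unfold bit
  split_ifs with h h' h'' h'' h' h'' h'' <;> simp_all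

/-- What the features are in a round in which the variables have their values from iteration `s`
and have had them for `r` rounds. -/
structure SchemaInvariant (ψ : T → Schema P T) (nodes : J → Schema P T) (m : ℕ)
    (G : LabeledGraph.{u} P) (t s r : ℕ) : Prop where
  clock : ∀ j v, (schemaNetwork ψ nodes m).run G t (schemaClock m j) v ↔ (r : ZMod (m + 1)) = j
  latch : ∀ X v, ((schemaNetwork ψ nodes m).run G t (schemaLatch m X true) v ∨
    (schemaNetwork ψ nodes m).run G t (schemaLatch m X false) v) ↔ Schema.iterate ψ G s X v
  not_both : ∀ X v, ¬ ((schemaNetwork ψ nodes m).run G t (schemaLatch m X true) v ∧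
    (schemaNetwork ψ nodes m).run G t (schemaLatch m X false) v)
  eval : ∀ j v, (nodes j).height ≤ r →
    ((schemaNetwork ψ nodes m).run G t (Sum.inl j) v ↔ (nodes j).Sat G (Schema.iterate ψ G s) v)

variable {ψ : T → Schema P T} {nodes : J → Schema P T} {m : ℕ} {G : LabeledGraph.{u} P}
  {t s r : ℕ}

theorem schemaInvariant_zero : SchemaInvariant ψ nodes m G 0 0 0 where
  clock j v := by
    rw [Nat.cast_zero]
    exact Iff.rfl
  latch X v := or_self_iff
  not_both X v h := h.1
  eval j v h := by
    change (∃ p ∈ G.lab v, nodes j = .sym p) ↔ _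
    cases hj : nodes j <;> simp [hj, Schema.height, Schema.Sat] at h ⊢

namespace SchemaInvariant

theorem clock_succ (h : SchemaInvariant ψ nodes m G t s r) (j : ZMod (m + 1)) (v : G.V) :
    (schemaNetwork ψ nodes m).run G (t + 1) (schemaClock m j) v ↔
      ((r + 1 : ℕ) : ZMod (m + 1)) = j := by
  change 1 ≤ ∑ i, _ * _ + (0 : ℤ) ↔ _
  simp only [sum_bit_mul_single]
  rw [add_zero, one_le_bit, h.clock, eq_sub_iff_add_eq, Nat.cast_succ]

theorem latch_true_succ (h : SchemaInvariant ψ nodes m G t s r) (hr : r ≤ m)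
    (hψ : ∀ X, ψ X ∈ Set.range nodes) (hm : ∀ X, (ψ X).height ≤ m) (X : T) (v : G.V) :
    (schemaNetwork ψ nodes m).run G (t + 1) (schemaLatch m X true) v ↔
      r = m ∧ (ψ X).Sat G (Schema.iterate ψ G s) v := by
  have hX : nodes (Function.invFun nodes (ψ X)) = ψ X := Function.invFun_eq (hψ X)
  have hc : (r : ZMod (m + 1)) = (m : ZMod (m + 1)) ↔ r = m := by
    rw [ZMod.natCast_eq_natCast_iff', Nat.mod_eq_of_lt (by omega), Nat.mod_eq_of_lt (by omega)]
  change 1 ≤ ∑ i, _ * _ + (-1 : ℤ) ↔ _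
  simp only [Pi.add_apply, mul_add, Finset.sum_add_distrib, sum_bit_mul_single]
  rw [one_le_bit_add_bit_sub_one, h.clock, hc, and_comm]
  refine and_congr_right fun hrm => ?_
  rw [schemaPos, h.eval _ _ (by rw [hX, hrm]; exact hm X), hX]

theorem latch_false_succ (h : SchemaInvariant ψ nodes m G t s r) (hr : r ≤ m) (X : T)
    (v : G.V) :
    (schemaNetwork ψ nodes m).run G (t + 1) (schemaLatch m X false) v ↔
      r ≠ m ∧ Schema.iterate ψ G s X v := by
  have hc : (r : ZMod (m + 1)) = (m : ZMod (m + 1)) ↔ r = m := by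
    rw [ZMod.natCast_eq_natCast_iff', Nat.mod_eq_of_lt (by omega), Nat.mod_eq_of_lt (by omega)]
  change 1 ≤ ∑ i, _ * _ + (0 : ℤ) ↔ _
  simp only [Pi.add_apply, Pi.neg_apply, mul_add, mul_neg, Finset.sum_add_distrib,
    Finset.sum_neg_distrib, sum_bit_mul_single, add_zero]
  rw [one_le_bit_add_bit_sub_bit (h.not_both X v), h.clock, hc, h.latch, and_comm]

theorem eval_succ (h : SchemaInvariant ψ nodes m G t s r)
    (hsub : ∀ j, (nodes j).sub ⊆ Set.range nodes) (j : J) (v : G.V)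
    (hj : (nodes j).height ≤ r + 1) :
    (schemaNetwork ψ nodes m).run G (t + 1) (Sum.inl j) v ↔
      (nodes j).Sat G (Schema.iterate ψ G s) v := by
  have hpos : ∀ φ ∈ (nodes j).sub, φ.height ≤ r → ∀ x,
      ((schemaNetwork ψ nodes m).run G t (schemaPos nodes m φ) x ↔
        φ.Sat G (Schema.iterate ψ G s) x) := by
    intro φ hφ hr x
    have hφ' : nodes (Function.invFun nodes φ) = φ := Function.invFun_eq (hsub j hφ)
    rw [schemaPos, h.eval _ _ (by rwa [hφ']), hφ']
  change ((nodes j).rule (schemaPos nodes m) (schemaLatch m)).Holds _ _ ↔ _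
  generalize nodes j = χ at hj hpos
  cases χ with
  | top => simp [Schema.rule, ThresholdRule.Holds, Schema.Sat]
  | sym p =>
    simp only [Schema.rule, ThresholdRule.Holds, sum_bit_mul_single, add_zero, one_le_bit]
    exact hpos _ (Schema.self_mem_sub _) (Nat.zero_le _) v
  | var X =>
    simp only [Schema.rule, ThresholdRule.Holds, Pi.add_apply, mul_add, Finset.sum_add_distrib,
      sum_bit_mul_single, add_zero, one_le_bit_add_bit]
    exact h.latch X v
  | neg φ =>
    simp only [Schema.rule, ThresholdRule.Holds, Pi.neg_apply, mul_neg, Finset.sum_neg_distrib,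
      sum_bit_mul_single, one_le_neg_bit_add_one]
    exact not_congr (hpos φ (Or.inr φ.self_mem_sub) (Nat.le_of_succ_le_succ hj) v)
  | conj φ χ =>
    simp only [Schema.rule, ThresholdRule.Holds, Pi.add_apply, mul_add, Finset.sum_add_distrib,
      sum_bit_mul_single, one_le_bit_add_bit_sub_one]
    have hj' := max_le_iff.1 (Nat.le_of_succ_le_succ hj)
    exact and_congr (hpos φ (Or.inr (Or.inl φ.self_mem_sub)) hj'.1 v)
      (hpos χ (Or.inr (Or.inr χ.self_mem_sub)) hj'.2 v)
  | dia k φ =>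
    cases k with
    | zero => simp [Schema.rule, ThresholdRule.Holds, Schema.Sat]
    | succ k =>
      simp only [Schema.rule, ThresholdRule.Holds, Schema.Sat,
        hpos φ (Or.inr φ.self_mem_sub) (Nat.le_of_succ_le_succ hj)]
      exact Iff.rfl

theorem succ (hsub : ∀ j, (nodes j).sub ⊆ Set.range nodes)
    (hψ : ∀ X, ψ X ∈ Set.range nodes) (hm : ∀ X, (ψ X).height ≤ m)
    (h : SchemaInvariant ψ nodes m G t s r) (hr : r < m) :
    SchemaInvariant ψ nodes m G (t + 1) s (r + 1) where
  clock := h.clock_succ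
  latch X v := by
    rw [h.latch_true_succ hr.le hψ hm, h.latch_false_succ hr.le]
    simp [hr.ne]
  not_both X v := by
    rw [h.latch_true_succ hr.le hψ hm, h.latch_false_succ hr.le]
    simp [hr.ne]
  eval := h.eval_succ hsub

theorem wrap (hsub : ∀ j, (nodes j).sub ⊆ Set.range nodes)
    (hψ : ∀ X, ψ X ∈ Set.range nodes) (hm : ∀ X, (ψ X).height ≤ m)
    (h : SchemaInvariant ψ nodes m G t s m) :
    SchemaInvariant ψ nodes m G (t + 1) (s + 1) 0 where
  clock j v := by
    rw [h.clock_succ, ZMod.natCast_self, Nat.cast_zero]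
  latch X v := by
    rw [h.latch_true_succ le_rfl hψ hm, h.latch_false_succ le_rfl]
    simp [Schema.iterate]
  not_both X v := by
    rw [h.latch_true_succ le_rfl hψ hm, h.latch_false_succ le_rfl]
    simp
  eval j v hj := by
    rw [h.eval_succ hsub j v (by omega)]
    cases hj' : nodes j <;> simp [hj', Schema.height, Schema.Sat] at hj ⊢

theorem all (hsub : ∀ j, (nodes j).sub ⊆ Set.range nodes)
    (hψ : ∀ X, ψ X ∈ Set.range nodes) (hm : ∀ X, (ψ X).height ≤ m)
    (G : LabeledGraph.{u} P) (s : ℕ) {r : ℕ} (hr : r ≤ m) :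
    SchemaInvariant ψ nodes m G ((m + 1) * s + r) s r := by
  have step : ∀ s, SchemaInvariant ψ nodes m G ((m + 1) * s) s 0 → ∀ r ≤ m,
      SchemaInvariant ψ nodes m G ((m + 1) * s + r) s r := by
    intro s hs r
    induction r with
    | zero => exact fun _ => hs
    | succ r ih => exact fun hr => succ hsub hψ hm (ih (by omega)) hr
  refine step s ?_ r hr
  induction s with
  | zero => exact schemaInvariant_zero
  | succ s ih => exact wrap hsub hψ hm (step s ih m le_rfl)

end SchemaInvariant

end network

theorem GMSC.exists_rSimple {P : Type w} (L : GMSC P) :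
    ∃ m : ℕ, ∃ N : FloatGNN P, N.IsRSimple ∧ ∀ (G : LabeledGraph.{u} P) (t : ℕ) (v : G.V),
      N.run G (t + (m + 1)) v ∈ N.accepting ↔ L.run G (t / (m + 1)) v ∈ L.accepting := by
  have hfin : (⋃ X, (L.delayed X).sub).Finite := Set.finite_iUnion fun X => Schema.finite_sub _
  have := hfin.to_subtype
  obtain ⟨k, ⟨e⟩⟩ := Finite.exists_equiv_fin (⋃ X, (L.delayed X).sub : Set _)
  let nodes : Fin k → Schema P (Option (Fin L.n)) := fun j => (e.symm j).1
  have hrange : Set.range nodes = ⋃ X, (L.delayed X).sub := by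
    rw [← Subtype.range_coe (s := ⋃ X, (L.delayed X).sub)]
    exact e.symm.surjective.range_comp _
  have hψ : ∀ X, L.delayed X ∈ Set.range nodes := fun X => by
    rw [hrange]
    exact Set.mem_iUnion.2 ⟨X, Schema.self_mem_sub _⟩
  have hsub : ∀ j, (nodes j).sub ⊆ Set.range nodes := fun j => by
    rw [hrange]
    obtain ⟨X, hX⟩ := Set.mem_iUnion.1 (e.symm j).2
    exact (Schema.sub_subset_sub hX).trans (Set.subset_iUnion (fun X => (L.delayed X).sub) X)
  have : Nonempty (Fin k) := ⟨(hψ none).choose⟩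
  obtain ⟨m, hm⟩ := Finite.exists_le fun X => (L.delayed X).height
  obtain ⟨N, hN, hrun⟩ := (schemaNetwork L.delayed nodes m).exists_rSimple
    {x | ∃ i ∈ L.appointed, x (schemaLatch m (some i) true) ∨ x (schemaLatch m (some i) false)}
  refine ⟨m, N, hN, fun G t v => (hrun G _ v).trans ?_⟩
  have hr : t % (m + 1) ≤ m := Nat.le_of_lt_succ (Nat.mod_lt _ (Nat.succ_pos m))
  have ht : t + (m + 1) = (m + 1) * (t / (m + 1) + 1) + t % (m + 1) := by
    linarith [Nat.div_add_mod t (m + 1)]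
  have h := SchemaInvariant.all hsub hψ hm G (t / (m + 1) + 1) hr
  rw [ht]
  simp only [Set.mem_ofPred_eq, h.latch, L.iterate_delayed]
  exact Iff.rfl

theorem gmscSystem_subset_rSimpleSystem {P : Type w} {C : RunClassifier}
    (hC : StutterInvariant C) : gmscSystem.{u} P C ⊆ rSimpleSystem P C := by
  rintro _ ⟨L, rfl⟩
  obtain ⟨m, N, hN, h⟩ := GMSC.exists_rSimple.{u} L
  exact ⟨N, hN, funext fun G => funext fun v => propext <|
    hC _ _ _ _ _ _ (m + 1) (m + 1) (Nat.succ_pos m) fun t => h G t v⟩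

theorem rSimpleSystem_subset_gnnfSystem (P : Type w) (C : RunClassifier) :
    rSimpleSystem.{u} P C ⊆ gnnfSystem P C := by
  rintro _ ⟨N, hN, rfl⟩
  exact ⟨N, hN.isGNNF, rfl⟩

theorem SameExpressivePower.of_subset {P : Type w} {A B : Set (NodeProperty.{u} P)}
    (h : A ⊆ B) (h' : B ⊆ A) : SameExpressivePower A B :=
  ⟨fun Q hQ => ⟨Q, h hQ, fun _ _ => Iff.rfl⟩, fun Q hQ => ⟨Q, h' hQ, fun _ _ => Iff.rfl⟩⟩

theorem sameExpressivePower_of_stutterInvariant (P : Type w) [Finite P] {C : RunClassifier}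
    (hC : StutterInvariant C) :
    SameExpressivePower (gmscSystem.{u} P C) (gnnfSystem.{u} P C) ∧
      SameExpressivePower (gnnfSystem.{u} P C) (rSimpleSystem.{u} P C) ∧
      SameExpressivePower (gmscSystem.{u} P C) (rSimpleSystem.{u} P C) := by
  have h1 : gmscSystem.{u} P C ⊆ rSimpleSystem P C := gmscSystem_subset_rSimpleSystem hC
  have h2 : rSimpleSystem.{u} P C ⊆ gnnfSystem P C := rSimpleSystem_subset_gnnfSystem P C
  have h3 : gnnfSystem.{u} P C ⊆ gmscSystem P C := gnnfSystem_subset_gmscSystem hC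
  exact ⟨.of_subset (h1.trans h2) h3, .of_subset (h3.trans h1) h2,
    .of_subset h1 (h2.trans h3)⟩

end RecGNN

end

theorem mainTheorem11 (P : Type w) [Finite P] :
    (RecGNN.SameExpressivePower
        (RecGNN.gmscSystem.{u} P RecGNN.fixedPoint) (RecGNN.gnnfSystem.{u} P RecGNN.fixedPoint) ∧
      RecGNN.SameExpressivePower
        (RecGNN.gnnfSystem.{u} P RecGNN.fixedPoint) (RecGNN.rSimpleSystem.{u} P RecGNN.fixedPoint) ∧
      RecGNN.SameExpressivePower
        (RecGNN.gmscSystem.{u} P RecGNN.fixedPoint) (RecGNN.rSimpleSystem.{u} P RecGNN.fixedPoint)) ∧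
    (RecGNN.SameExpressivePower
        (RecGNN.gmscSystem.{u} P RecGNN.buchi) (RecGNN.gnnfSystem.{u} P RecGNN.buchi) ∧
      RecGNN.SameExpressivePower
        (RecGNN.gnnfSystem.{u} P RecGNN.buchi) (RecGNN.rSimpleSystem.{u} P RecGNN.buchi) ∧
      RecGNN.SameExpressivePower
        (RecGNN.gmscSystem.{u} P RecGNN.buchi) (RecGNN.rSimpleSystem.{u} P RecGNN.buchi)) := by
  exact ⟨RecGNN.sameExpressivePower_of_stutterInvariant P RecGNN.stutterInvariant_fixedPoint,
    RecGNN.sameExpressivePower_of_stutterInvariant P RecGNN.stutterInvariant_buchi⟩
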